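/- Let $d\ge 0$ and $[d]=\{1,\dots,d\}$, and let $P=\{p_1,\dots,p_d\}$ and $Q=\{q_1,\dots,q_d\}$ be partially ordered sets with $d$ elements each. The chain polytope of $P$ is $$\mathcal C(P)=\Big\{x\in\mathbb R^d \;:\; x_i\ge 0 \text{ for all } i\in[d],\ \ \sum_{i\in C}x_i\le 1 \text{ for every } C\subseteq[d] \text{ such that } \{p_i: i\in C\} \text{ is a chain of } P\Big\},$$ and $\mathcal C(Q)$ is defined in the same way. The twinned chain polytope $\Gamma(\mathcal C(P),-\mathcal C(Q))\subset\mathbb R^d$ is the convex hull of $\mathcal C(P)\cup(-\mathcal C(Q))$. For $W\subseteq[d]$ let $P_W=\{p_i: i\in W\}$ and $Q_{[d]\setminus W}=\{q_j: j\in[d]\setminus W\}$ carry the induced orders, and let $\Delta_W(P,Q)=P_W\oplus Q_{[d]\setminus W}$ be their ordinal sum: the disjoint union of the two posets, with the order of $P$ on $P_W$, the order of $Q$ on $Q_{[d]\setminus W}$, and every element of $P_W$ below every element of $Q_{[d]\setminus W}$. Write $\Delta_W(P,Q)=\{r_1,\dots,r_d\}$ with $r_i=p_i$ for $i\in W$ and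 $r_i=q_i$ for $i\notin W$, and let $e(\Delta_W(P,Q))$ be the number of its linear extensions, i.e. of permutations $i_1i_2\cdots i_d$ of $[d]$ such that $a<b$ whenever $r_{i_a}<r_{i_b}$. Then $$\operatorname{vol}\big(\Gamma(\mathcal C(P),-\mathcal C(Q))\big)=\sum_{W\subseteq[d]}\frac{e(\Delta_W(P,Q))}{d!},$$ where $\operatorname{vol}$ is the $d$-dimensional Lebesgue measure. -/

import Mathlib

open MeasureTheory
open scoped Nat Pointwise ENNReal

/-- A finite poset `P = {p_1, …, p_d}` is a partially ordered type `P` together with an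
enumeration `p : Fin d ≃ P` of its elements.

The (Stanley) chain polytope `C(P) ⊆ ℝ^d`: all `x` with nonnegative coordinates whose
coordinate sum along each chain of `P` is at most `1`. -/
def chainPolytope {d : ℕ} {P : Type*} [PartialOrder P] (p : Fin d ≃ P) : Set (Fin d → ℝ) :=
  {x | (∀ i, 0 ≤ x i) ∧
    ∀ C : Finset (Fin d), IsChain (fun i j => p i ≤ p j) (C : Set (Fin d)) → ∑ i ∈ C, x i ≤ 1}

/-- The twinned chain polytope `Γ(C(P), -C(Q))`: the convex hull of `C(P) ∪ (-C(Q))`. -/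
def twinnedChainPolytope {d : ℕ} {P Q : Type*} [PartialOrder P] [PartialOrder Q]
    (p : Fin d ≃ P) (q : Fin d ≃ Q) : Set (Fin d → ℝ) :=
  convexHull ℝ (chainPolytope p ∪ -chainPolytope q)

/-- The linear extensions of `R = {r_1, …, r_d}`: permutations `σ = i_1 i_2 ⋯ i_d` of the index
set such that `r_{i_a} < r_{i_b}` implies `a < b`. -/
def linearExtensions {d : ℕ} {R : Type*} [PartialOrder R] (r : Fin d ≃ R) :
    Set (Equiv.Perm (Fin d)) :=
  {σ | ∀ a b, r (σ a) < r (σ b) → a < b}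

/-- `e(R)`, the number of linear extensions of `R`. -/
noncomputable def numLinearExtensions {d : ℕ} {R : Type*} [PartialOrder R] (r : Fin d ≃ R) : ℕ :=
  (linearExtensions r).ncard

/-- The induced subposet `P_W = {p_i | i ∈ W}` of `P`. -/
abbrev InducedSubposet {d : ℕ} {P : Type*} (p : Fin d ≃ P) (W : Finset (Fin d)) : Type _ :=
  {x : P // p.symm x ∈ W}

/-- `Δ_W(P, Q)`: the ordinal sum (Mathlib's linear sum of orders) of `P_W` and `Q_{[d] ∖ W}`,
where every element of `P_W` lies below every element of `Q_{[d] ∖ W}`. -/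
abbrev Delta {d : ℕ} {P Q : Type*} (p : Fin d ≃ P) (q : Fin d ≃ Q) (W : Finset (Fin d)) : Type _ :=
  InducedSubposet p W ⊕ₗ InducedSubposet q Wᶜ

/-- The enumeration of `Δ_W(P, Q)` by `[d]`: the element with index `i` is `p_i` if `i ∈ W`,
and `q_i` if `i ∉ W`. -/
def deltaEnum {d : ℕ} {P Q : Type*} (p : Fin d ≃ P) (q : Fin d ≃ Q) (W : Finset (Fin d)) :
    Fin d ≃ Delta p q W where
  toFun i :=
    if h : i ∈ W then toLex (Sum.inl ⟨p i, by simpa using h⟩)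
    else toLex (Sum.inr ⟨q i, by simpa using h⟩)
  invFun x := Sum.elim (fun y => p.symm y.1) (fun z => q.symm z.1) (ofLex x)
  left_inv i := by
    by_cases h : i ∈ W <;> simp [h]
  right_inv x := by
    rcases hx : ofLex x with ⟨y, hy⟩ | ⟨z, hz⟩
    · have : x = toLex (Sum.inl ⟨y, hy⟩) := by rw [← hx]; rfl
      subst this
      simp [hy]
    · have : x = toLex (Sum.inr ⟨z, hz⟩) := by rw [← hx]; rfl
      subst this
      have hz' : q.symm z ∉ W := by simpa using hz
      simp [hz']

/-! Cut the twinned polytope by coordinate orthants. Let `W` index the coordinates where `x` is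
nonnegative, and let `x⁺`, `x⁻` be the parts of `x` on `W` and off `W`, both taken nonnegative. A
point lies in the convex hull iff it is `s • a - (1 - s) • b` with `a`, `b` in the two chain
polytopes, which amounts to: largest `P`-chain sum of `x⁺` plus largest `Q`-chain sum of `x⁻` is at
most `1`. Chains of `Δ_W` are exactly unions of a chain of `P_W` and a chain of `Q_{Wᶜ}`, so each
orthant piece is a reflected chain polytope of `Δ_W` (`twinnedChainPolytope_eq_biUnion`). The pieces
overlap in null sets.

It remains to prove Stanley's formula `volume_chainPolytope`. The transfer map is triangular, hence
volume preserving, and pulls the chain polytope back to the order polytope, which splits into one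
simplex of volume `1 / d!` per linear extension. -/

/-! ### Volume-preserving triangular maps -/

section Shear

variable {ι : Type*} [Fintype ι] [DecidableEq ι]

/-- Shearing one coordinate by a function of the other coordinates preserves Lebesgue measure. -/
theorem measurePreserving_update_add (i : ι) {g : (ι → ℝ) → ℝ} (hg : Measurable g)
    (hgi : ∀ x t, g (Function.update x i t) = g x) :
    MeasurePreserving (fun x : ι → ℝ => Function.update x i (x i + g x)) := by
  have hm : Measurable (fun x : ι → ℝ => Function.update x i (x i + g x)) := by
    refine measurable_pi_lambda _ fun j => ?_
    by_cases h : j = i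
    · subst h
      simp only [Function.update_self]
      exact (measurable_pi_apply j).add hg
    · simpa [Function.update_of_ne h] using measurable_pi_apply j
  refine ⟨hm, Measure.ext fun s hs => ?_⟩
  rw [Measure.map_apply hm hs, ← lintegral_indicator_one hs,
    ← lintegral_indicator_one (hm hs)]
  -- With the other coordinates fixed, the map translates coordinate `i` by a constant, so the
  -- integrals over that coordinate already agree.
  refine lintegral_eq_of_lmarginal_eq {i} (measurable_one.indicator (hm hs))
    (measurable_one.indicator hs) ?_
  simp_rw [lmarginal_singleton]
  ext x
  rw [← lintegral_add_right_eq_self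
    (fun t => s.indicator (1 : (ι → ℝ) → ℝ≥0∞) (Function.update x i t)) (g x)]
  refine lintegral_congr fun t => ?_
  have hmem : Function.update x i t ∈ (fun x => Function.update x i (x i + g x)) ⁻¹' s ↔
      Function.update x i (t + g x) ∈ s := by
    rw [Set.mem_preimage]
    simp [hgi]
  by_cases h : Function.update x i (t + g x) ∈ s
  · rw [Set.indicator_of_mem h, Set.indicator_of_mem (hmem.2 h)]
    rfl
  · rw [Set.indicator_of_notMem h, Set.indicator_of_notMem (mt hmem.1 h)]

/-- A map whose `i`-th coordinate is `x i` plus a function of the coordinates strictly below `i`,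
with respect to a partial order, preserves Lebesgue measure. -/
theorem measurePreserving_triangular {R : Type*} [PartialOrder R] (r : ι → R)
    {g : ι → (ι → ℝ) → ℝ} (hg : ∀ i, Measurable (g i))
    (hgi : ∀ i x y, (∀ j, r j < r i → x j = y j) → g i x = g i y) :
    MeasurePreserving (fun (x : ι → ℝ) i => x i + g i x) := by
  have key : ∀ s : Finset ι,
      MeasurePreserving (fun (x : ι → ℝ) i => if i ∈ s then x i + g i x else x i) := by
    intro s
    induction s using Finset.strongInduction with
    | H s ih =>
      rcases s.eq_empty_or_nonempty with rfl | hs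
      · simp only [Finset.notMem_empty, if_false]
        exact MeasurePreserving.id (volume : Measure (ι → ℝ))
      -- The minimal coordinate is sheared last: `g i` reads only coordinates below `i`, which lie
      -- outside `s` and are still unchanged.
      obtain ⟨i, his, hi⟩ := s.exists_minimalFor r hs
      have hmin : ∀ j, r j < r i → j ∉ s := fun j hj hjs => hj.not_ge (hi hjs hj.le)
      have hshear := measurePreserving_update_add i (hg i) (fun x t => hgi i _ _ fun j hj =>
        Function.update_of_ne (by rintro rfl; exact lt_irrefl _ hj) _ _)
      convert hshear.comp (ih _ (Finset.erase_ssubset his)) using 1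
      funext x j
      by_cases hj : j = i
      · subst hj
        simp only [his, if_true, Function.comp, Function.update_self, Finset.mem_erase, ne_eq,
          not_true, false_and, if_false]
        congr 1
        refine hgi _ _ _ fun k hk => ?_
        simp [hmin k hk]
      · simp [hj]
  simpa using key Finset.univ

end Shear

/-! ### Stanley's transfer between order and chain polytopes -/

section OrderPolytope

variable {d : ℕ} {R : Type*} [PartialOrder R] (r : Fin d ≃ R)

/-- The order polytope of `R`: order-preserving maps to the unit interval. -/
def orderPolytope : Set (Fin d → ℝ) :=
  {x | (∀ i, 0 ≤ x i ∧ x i ≤ 1) ∧ ∀ i j, r i < r j → x i ≤ x j}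

open Classical in
/-- The largest coordinate of `x` strictly below the `i`-th element, or `0` if this is larger. -/
noncomputable def maxBelow (i : Fin d) (x : Fin d → ℝ) : ℝ :=
  (Finset.univ.filter fun j => r j < r i).fold max 0 x

/-- Stanley's transfer map from the order polytope to the chain polytope. -/
noncomputable def transferMap (x : Fin d → ℝ) (i : Fin d) : ℝ :=
  x i - maxBelow r i x

theorem maxBelow_nonneg (i : Fin d) (x : Fin d → ℝ) : 0 ≤ maxBelow r i x := by
  classical
  exact (Finset.fold_max_le _ |>.1 le_rfl).1

theorem le_maxBelow {i j : Fin d} (x : Fin d → ℝ) (h : r j < r i) : x j ≤ maxBelow r i x := by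
  classical
  exact (Finset.fold_max_le _ |>.1 le_rfl).2 j (by simpa using h)

theorem maxBelow_le {i : Fin d} {x : Fin d → ℝ} {c : ℝ} (hc : 0 ≤ c)
    (h : ∀ j, r j < r i → x j ≤ c) : maxBelow r i x ≤ c := by
  classical
  exact (Finset.fold_max_le _).2 ⟨hc, fun j hj => h j (by simpa using hj)⟩

theorem maxBelow_eq (i : Fin d) (x : Fin d → ℝ) :
    maxBelow r i x = 0 ∨ ∃ j, r j < r i ∧ maxBelow r i x = x j := by
  classical
  rcases (Finset.le_fold_max (c := maxBelow r i x)).1 le_rfl with h | ⟨j, hj, h⟩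
  · exact Or.inl (le_antisymm h (maxBelow_nonneg r i x))
  · have hj : r j < r i := by simpa using hj
    exact Or.inr ⟨j, hj, le_antisymm h (le_maxBelow r x hj)⟩

theorem measurable_maxBelow (i : Fin d) : Measurable (maxBelow r i) := by
  classical
  unfold maxBelow
  generalize (Finset.univ.filter fun j => r j < r i) = s
  induction s using Finset.induction_on with
  | empty => simp
  | insert a s ha ih =>
    simp only [Finset.fold_insert ha]
    exact (measurable_pi_apply a).max ih

theorem measurePreserving_transferMap : MeasurePreserving (transferMap r) := by
  have := measurePreserving_triangular (r := r) (g := fun i x => - maxBelow r i x)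
    (fun i => (measurable_maxBelow r i).neg) (fun i x y h => by
      have : maxBelow r i x = maxBelow r i y := Finset.fold_congr fun j hj => h j (by simpa using hj)
      simp [this])
  simp only [← sub_eq_add_neg] at this
  exact this

/-- The sum telescopes from the top `k` of the chain: the rest lies below `k`, so by induction it
sums to at most `maxBelow r k x`, the amount subtracted at `k`. This use needs `c` to vary. -/
theorem sum_transferMap_le {x : Fin d → ℝ} (C : Finset (Fin d))
    (hC : IsChain (fun i j => r i ≤ r j) (C : Set (Fin d))) {c : ℝ} (hc : 0 ≤ c)
    (h : ∀ i ∈ C, x i ≤ c) : ∑ i ∈ C, transferMap r x i ≤ c := by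
  induction C using Finset.strongInduction generalizing c with
  | H C ih =>
    rcases C.eq_empty_or_nonempty with rfl | hne
    · simpa using hc
    obtain ⟨k, hk, hmax⟩ := C.exists_maximalFor r hne
    rw [← Finset.add_sum_erase _ _ hk]
    have hrest := ih (C.erase k) (Finset.erase_ssubset hk)
      (hC.mono (by simp)) (maxBelow_nonneg r k x) (fun i hi => by
        obtain ⟨hik, hiC⟩ := Finset.mem_erase.1 hi
        refine le_maxBelow r x (lt_of_le_of_ne ?_ (r.injective.ne hik))
        rcases hC hiC hk hik with h | h
        · exact h
        · exact hmax hiC h)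
    have := h k hk
    unfold transferMap at *
    linarith

/-- Descending each time to an element that attains `maxBelow` gives a chain along which the sum
telescopes exactly. -/
theorem exists_chain_sum_transferMap (x : Fin d → ℝ) (i : Fin d) :
    ∃ C : Finset (Fin d), IsChain (fun i j => r i ≤ r j) (C : Set (Fin d)) ∧
      (∀ j ∈ C, r j ≤ r i) ∧ ∑ j ∈ C, transferMap r x j = x i := by
  have : Finite R := Finite.of_equiv _ r
  have wf : WellFounded (fun i j : Fin d => r i < r j) := InvImage.wf r wellFounded_lt
  induction i using wf.induction with
  | _ i ih =>
    rcases maxBelow_eq r i x with h0 | ⟨j, hj, h⟩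
    · exact ⟨{i}, by simp, by simp, by simp [transferMap, h0]⟩
    · obtain ⟨C, hC, hle, hsum⟩ := ih j hj
      have hi : i ∉ C := fun hi => (hle i hi).not_gt hj
      refine ⟨insert i C, ?_, ?_, ?_⟩
      · rw [Finset.coe_insert]
        exact hC.insert fun k hk _ => Or.inr ((hle k hk).trans hj.le)
      · simpa using fun k hk => (hle k hk).trans hj.le
      · rw [Finset.sum_insert hi, hsum, transferMap, h]
        ring

/-- Equality of preimages suffices for comparing volumes, so no inverse of the transfer map is
needed. -/
theorem transferMap_preimage_chainPolytope :
    transferMap r ⁻¹' chainPolytope r = orderPolytope r := by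
  ext x
  constructor
  · rintro ⟨h0, h1⟩
    have hle : ∀ i, maxBelow r i x ≤ x i := fun i => sub_nonneg.1 (h0 i)
    have hx : ∀ i, 0 ≤ x i := fun i => (maxBelow_nonneg r i x).trans (hle i)
    refine ⟨fun i => ⟨hx i, ?_⟩, fun i j hij => (le_maxBelow r x hij).trans (hle j)⟩
    obtain ⟨C, hC, -, hsum⟩ := exists_chain_sum_transferMap r x i
    exact hsum ▸ h1 C hC
  · rintro ⟨h0, h1⟩
    refine ⟨fun i => sub_nonneg.2 (maxBelow_le r (h0 i).1 fun j hj => h1 j i hj), fun C hC => ?_⟩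
    exact sum_transferMap_le r C hC zero_le_one fun i _ => (h0 i).2

theorem measurableSet_chainPolytope : MeasurableSet (chainPolytope r) := by
  have : chainPolytope r = (⋂ i, {x | 0 ≤ x i}) ∩ ⋂ C : Finset (Fin d),
      ⋂ _ : IsChain (fun i j => r i ≤ r j) (C : Set (Fin d)), {x | ∑ i ∈ C, x i ≤ 1} := by
    ext x
    simp [chainPolytope]
  rw [this]
  refine (MeasurableSet.iInter fun i => measurableSet_le (by fun_prop) (by fun_prop)).inter
    (MeasurableSet.iInter fun C => MeasurableSet.iInter fun _ =>
      measurableSet_le (by fun_prop) (by fun_prop))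

theorem volume_chainPolytope_eq_volume_orderPolytope :
    volume (chainPolytope r) = volume (orderPolytope r) := by
  rw [← transferMap_preimage_chainPolytope,
    (measurePreserving_transferMap r).measure_preimage
      (measurableSet_chainPolytope r).nullMeasurableSet]

/-! ### Decomposition of the order polytope into sorted simplices -/

theorem ae_injective_pi : ∀ᵐ x : Fin d → ℝ, Function.Injective x := by
  have : ∀ i j : Fin d, i ≠ j → ∀ᵐ x : Fin d → ℝ, x i ≠ x j := by
    intro i j hij
    let L : (Fin d → ℝ) →ₗ[ℝ] ℝ :=
      (LinearMap.proj i : (Fin d → ℝ) →ₗ[ℝ] ℝ) - (LinearMap.proj j : (Fin d → ℝ) →ₗ[ℝ] ℝ)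
    have hL : ∀ x, L x = x i - x j := fun x => LinearMap.sub_apply _ _ x
    have h := Measure.addHaar_submodule (volume : Measure (Fin d → ℝ)) (LinearMap.ker L) (by
      rw [Ne, LinearMap.ker_eq_top]
      intro h
      have h1 := hL (Pi.single i 1)
      simp [h, hij.symm] at h1)
    rw [ae_iff]
    convert h using 2
    ext x
    simp [hL, sub_eq_zero]
  have h2 : ∀ᵐ x : Fin d → ℝ, ∀ i j : Fin d, i ≠ j → x i ≠ x j := by
    simpa only [ae_all_iff] using this
  filter_upwards [h2] with x hx i j hij
  by_contra h
  exact hx i j h hij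

/-- The points of the unit cube whose coordinates are sorted by `σ`. -/
def sortedSimplex (σ : Equiv.Perm (Fin d)) : Set (Fin d → ℝ) :=
  {x | (∀ i, 0 ≤ x i ∧ x i ≤ 1) ∧ Monotone (x ∘ σ)}

theorem measurableSet_sortedSimplex (σ : Equiv.Perm (Fin d)) :
    MeasurableSet (sortedSimplex σ) := by
  have : sortedSimplex σ = (⋂ i, {x | 0 ≤ x i} ∩ {x | x i ≤ 1}) ∩
      ⋂ i, ⋂ j, ⋂ _ : i ≤ j, {x | x (σ i) ≤ x (σ j)} := by
    ext x
    simp [sortedSimplex, Monotone]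
  rw [this]
  exact (MeasurableSet.iInter fun i => (measurableSet_le (by fun_prop) (by fun_prop)).inter
    (measurableSet_le (by fun_prop) (by fun_prop))).inter
    (MeasurableSet.iInter fun i => MeasurableSet.iInter fun j => MeasurableSet.iInter fun _ =>
      measurableSet_le (by fun_prop) (by fun_prop))

theorem aedisjoint_sortedSimplex :
    Pairwise (Function.onFun (AEDisjoint volume) (sortedSimplex (d := d))) := by
  intro σ τ hστ
  have h : ∀ᵐ x : Fin d → ℝ, x ∉ sortedSimplex σ ∩ sortedSimplex τ := by
    filter_upwards [ae_injective_pi] with x hx ⟨h1, h2⟩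
    refine hστ (Equiv.ext fun i => hx ?_)
    exact congrFun (Tuple.unique_monotone h1.2 h2.2) i
  exact measure_eq_zero_iff_ae_notMem.2 h

theorem volume_biUnion_sortedSimplex (s : Finset (Equiv.Perm (Fin d))) :
    volume (⋃ σ ∈ s, sortedSimplex σ) = ∑ σ ∈ s, volume (sortedSimplex σ) :=
  measure_biUnion_finset₀ (aedisjoint_sortedSimplex.set_pairwise _)
    fun σ _ => (measurableSet_sortedSimplex σ).nullMeasurableSet

theorem volume_sortedSimplex_eq (σ : Equiv.Perm (Fin d)) :
    volume (sortedSimplex σ) = volume (sortedSimplex (1 : Equiv.Perm (Fin d))) := by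
  have h := volume_measurePreserving_piCongrLeft (fun _ : Fin d => ℝ) σ
  rw [← h.measure_preimage (measurableSet_sortedSimplex σ).nullMeasurableSet]
  congr 1
  ext x
  have hx : ∀ i, MeasurableEquiv.piCongrLeft (fun _ : Fin d => ℝ) σ x (σ i) = x i := fun i =>
    Equiv.piCongrLeft_apply_apply (fun _ : Fin d => ℝ) σ x i
  simp only [sortedSimplex, Set.mem_preimage, Set.mem_ofPred_eq, Equiv.Perm.coe_one,
    Function.comp_id]
  rw [← σ.forall_congr_right]
  simp only [Function.comp_def, hx]

/-- The `d!` simplices are congruent and tile the unit cube up to null sets. -/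
theorem volume_sortedSimplex (σ : Equiv.Perm (Fin d)) :
    volume (sortedSimplex σ) = (d ! : ℝ≥0∞)⁻¹ := by
  have hcube : (⋃ σ ∈ (Finset.univ : Finset (Equiv.Perm (Fin d))), sortedSimplex σ) =
      Set.univ.pi fun _ : Fin d => Set.Icc (0 : ℝ) 1 := by
    ext x
    simp only [Finset.mem_univ, Set.iUnion_true, Set.mem_iUnion, sortedSimplex, Set.mem_ofPred_eq,
      Set.mem_univ_pi, Set.mem_Icc]
    exact ⟨fun ⟨_, h, _⟩ => h, fun h => ⟨Tuple.sort x, h, Tuple.monotone_sort x⟩⟩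
  have h := volume_biUnion_sortedSimplex (Finset.univ : Finset (Equiv.Perm (Fin d)))
  rw [hcube, volume_pi_pi, Finset.sum_congr rfl fun τ _ =>
    (volume_sortedSimplex_eq τ).trans (volume_sortedSimplex_eq σ).symm] at h
  simp only [Real.volume_Icc, sub_zero, ENNReal.ofReal_one, Finset.prod_const_one,
    Finset.sum_const, Finset.card_univ, Fintype.card_perm, Fintype.card_fin, nsmul_eq_mul] at h
  exact ENNReal.eq_inv_of_mul_eq_one_left (by rw [mul_comm, ← h])

theorem volume_orderPolytope :
    volume (orderPolytope r) = (numLinearExtensions r : ℝ≥0∞) / (d ! : ℝ≥0∞) := by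
  classical
  -- Distinct coordinates are needed: with ties, the sorting permutation may fail to be a linear
  -- extension.
  have h : orderPolytope r =ᵐ[volume] ⋃ σ ∈ (linearExtensions r).toFinset, sortedSimplex σ := by
    filter_upwards [ae_injective_pi] with x hx
    refine propext ⟨fun hxO => ?_, fun hxU => ?_⟩
    · refine Set.mem_biUnion (x := Tuple.sort x) ?_ ⟨hxO.1, Tuple.monotone_sort x⟩
      rw [Finset.mem_coe, Set.mem_toFinset]
      intro a b hab
      by_contra! hba
      have h1 := Tuple.monotone_sort x hba
      have h2 := hxO.2 _ _ hab
      exact hab.ne (congrArg r (hx (le_antisymm h2 h1)))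
    · obtain ⟨σ, hσ, hxσ⟩ := Set.mem_iUnion₂.1 hxU
      refine ⟨hxσ.1, fun i j hij => ?_⟩
      have hlt : σ.symm i < σ.symm j :=
        (Set.mem_toFinset.1 hσ) _ _ (by simpa using hij)
      simpa using hxσ.2 hlt.le
  rw [measure_congr h, volume_biUnion_sortedSimplex]
  simp [volume_sortedSimplex, numLinearExtensions, Set.ncard_eq_toFinset_card', div_eq_mul_inv]

/-- Stanley: the volume of the chain polytope is the number of linear extensions over `d !`. -/
theorem volume_chainPolytope :
    volume (chainPolytope r) = (numLinearExtensions r : ℝ≥0∞) / (d ! : ℝ≥0∞) := by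
  rw [volume_chainPolytope_eq_volume_orderPolytope, volume_orderPolytope]

end OrderPolytope

/-! ### Orthant decomposition of the twinned polytope -/

section Twinned

variable {d : ℕ}

theorem zero_mem_chainPolytope {R : Type*} [PartialOrder R] (r : Fin d ≃ R) :
    (0 : Fin d → ℝ) ∈ chainPolytope r := by
  simp [chainPolytope]

theorem convex_chainPolytope {R : Type*} [PartialOrder R] (r : Fin d ≃ R) :
    Convex ℝ (chainPolytope r) := by
  rintro x ⟨hx0, hx1⟩ y ⟨hy0, hy1⟩ a b ha hb hab
  refine ⟨fun i => ?_, fun C hC => ?_⟩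
  · have := mul_nonneg ha (hx0 i)
    have := mul_nonneg hb (hy0 i)
    simp only [Pi.add_apply, Pi.smul_apply, smul_eq_mul]
    linarith
  · simp only [Pi.add_apply, Pi.smul_apply, smul_eq_mul, Finset.sum_add_distrib, ← Finset.mul_sum]
    nlinarith [mul_le_mul_of_nonneg_left (hx1 C hC) ha, mul_le_mul_of_nonneg_left (hy1 C hC) hb]

/-- A nonnegative vector all of whose chain sums are at most `c` lies in `c • chainPolytope r`. -/
theorem exists_mem_chainPolytope_smul_eq {R : Type*} [PartialOrder R] (r : Fin d ≃ R)
    {u : Fin d → ℝ} (hu : ∀ i, 0 ≤ u i) {c : ℝ} (hc : 0 ≤ c)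
    (h : ∀ C : Finset (Fin d), IsChain (fun i j => r i ≤ r j) (C : Set (Fin d)) →
      ∑ i ∈ C, u i ≤ c) : ∃ a ∈ chainPolytope r, c • a = u := by
  -- For `c = 0` rescaling is impossible, but singleton chains force `u = 0`.
  rcases hc.eq_or_lt with rfl | hc
  · refine ⟨0, zero_mem_chainPolytope r, ?_⟩
    ext i
    have := h {i} (by simp)
    simp only [Finset.sum_singleton] at this
    simpa using le_antisymm (hu i) this
  · refine ⟨c⁻¹ • u, ⟨fun i => ?_, fun C hC => ?_⟩, smul_inv_smul₀ hc.ne' u⟩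
    · exact mul_nonneg (inv_nonneg.2 hc.le) (hu i)
    · simp only [Pi.smul_apply, smul_eq_mul, ← Finset.mul_sum]
      rw [inv_mul_le_iff₀ hc, mul_one]
      exact h C hC

variable {P Q : Type*} [PartialOrder P] [PartialOrder Q] (p : Fin d ≃ P) (q : Fin d ≃ Q)

theorem deltaEnum_le_iff (W : Finset (Fin d)) (i j : Fin d) :
    deltaEnum p q W i ≤ deltaEnum p q W j ↔
      (i ∈ W ∧ j ∈ W ∧ p i ≤ p j) ∨ (i ∉ W ∧ j ∉ W ∧ q i ≤ q j) ∨ (i ∈ W ∧ j ∉ W) := by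
  by_cases hi : i ∈ W <;> by_cases hj : j ∈ W <;>
    simp [deltaEnum, hi, hj, Sum.Lex.toLex_le_toLex]

/-- Elements from different summands are always comparable, so only comparisons within each summand
matter. -/
theorem isChain_deltaEnum_iff (W C : Finset (Fin d)) :
    IsChain (fun i j => deltaEnum p q W i ≤ deltaEnum p q W j) (C : Set (Fin d)) ↔
      IsChain (fun i j => p i ≤ p j) ((C ∩ W : Finset (Fin d)) : Set (Fin d)) ∧
      IsChain (fun i j => q i ≤ q j) ((C \ W : Finset (Fin d)) : Set (Fin d)) := by
  simp only [IsChain, Set.Pairwise, deltaEnum_le_iff, Finset.mem_coe, Finset.mem_inter,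
    Finset.mem_sdiff]
  constructor
  · intro h
    constructor
    · rintro i ⟨hi, hiW⟩ j ⟨hj, hjW⟩ hij
      have := h hi hj hij
      tauto
    · rintro i ⟨hi, hiW⟩ j ⟨hj, hjW⟩ hij
      have := h hi hj hij
      tauto
  · rintro ⟨h1, h2⟩ i hi j hj hij
    by_cases hiW : i ∈ W <;> by_cases hjW : j ∈ W
    · simpa [hiW, hjW] using h1 ⟨hi, hiW⟩ ⟨hj, hjW⟩ hij
    · simp [hiW, hjW]
    · simp [hiW, hjW]
    · simpa [hiW, hjW] using h2 ⟨hi, hiW⟩ ⟨hj, hjW⟩ hij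

/-- Negating the coordinates outside of `W`. -/
def flipOutside (W : Finset (Fin d)) (x : Fin d → ℝ) (i : Fin d) : ℝ :=
  if i ∈ W then x i else -x i

theorem measurePreserving_flipOutside (W : Finset (Fin d)) :
    MeasurePreserving (flipOutside W) := by
  refine volume_preserving_pi (f := fun i t => if i ∈ W then t else -t) fun i => ?_
  by_cases h : i ∈ W
  · simp only [h, if_true]
    exact MeasurePreserving.id (volume : Measure ℝ)
  · simpa [h] using Measure.measurePreserving_neg (volume : Measure ℝ)

theorem sum_flipOutside (W C : Finset (Fin d)) (x : Fin d → ℝ) :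
    ∑ i ∈ C, flipOutside W x i = ∑ i ∈ C ∩ W, x i + ∑ i ∈ C \ W, -x i := by
  simp [flipOutside, Finset.sum_ite, Finset.filter_mem_eq_inter, Finset.filter_notMem_eq_sdiff]

theorem twinnedChainPolytope_subset {x : Fin d → ℝ} (hx : x ∈ twinnedChainPolytope p q) :
    ∃ W, flipOutside W x ∈ chainPolytope (deltaEnum p q W) := by
  classical
  have hneg : (0 : Fin d → ℝ) ∈ -chainPolytope q := by
    simpa using zero_mem_chainPolytope q
  rw [twinnedChainPolytope, (convex_chainPolytope p).convexHull_union (convex_chainPolytope q).neg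
    ⟨0, zero_mem_chainPolytope p⟩ ⟨0, hneg⟩, mem_convexJoin] at hx
  obtain ⟨a, ⟨ha0, ha1⟩, b, hb, s, t, hs, ht, hst, rfl⟩ := hx
  obtain ⟨hb0, hb1⟩ := Set.mem_neg.1 hb
  simp only [Pi.neg_apply] at hb0 hb1
  set x := s • a + t • b with hx
  have hxi : ∀ i, x i = s * a i + t * b i := fun i => rfl
  -- Since `a ≥ 0 ≥ b`, cancellation only helps: `x ≤ s • a` and `-x ≤ t • (-b)`. A chain of `Δ_W`
  -- then has sum at most `s + t = 1`.
  refine ⟨Finset.univ.filter fun i => 0 ≤ x i, fun i => ?_, fun C hC => ?_⟩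
  · simp only [flipOutside, Finset.mem_filter, Finset.mem_univ, true_and]
    split_ifs with h
    · exact h
    · linarith
  · rw [isChain_deltaEnum_iff] at hC
    rw [sum_flipOutside]
    have h1 : ∀ D : Finset (Fin d), ∑ i ∈ D, x i ≤ s * ∑ i ∈ D, a i := fun D => by
      rw [Finset.mul_sum]
      refine Finset.sum_le_sum fun i _ => ?_
      have := mul_nonneg ht (hb0 i)
      rw [hxi]
      linarith
    have h2 : ∀ D : Finset (Fin d), ∑ i ∈ D, -x i ≤ t * ∑ i ∈ D, -b i := fun D => by
      rw [Finset.mul_sum]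
      refine Finset.sum_le_sum fun i _ => ?_
      have := mul_nonneg hs (ha0 i)
      rw [hxi]
      linarith
    have h3 := mul_le_mul_of_nonneg_left (ha1 _ hC.1) hs
    have h4 := mul_le_mul_of_nonneg_left (hb1 _ hC.2) ht
    linarith [h1 (C ∩ Finset.univ.filter fun i => 0 ≤ x i),
      h2 (C \ Finset.univ.filter fun i => 0 ≤ x i)]

theorem mem_twinnedChainPolytope_of_flipOutside_mem {x : Fin d → ℝ} {W : Finset (Fin d)}
    (hx : flipOutside W x ∈ chainPolytope (deltaEnum p q W)) :
    x ∈ twinnedChainPolytope p q := by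
  classical
  obtain ⟨h0, h1⟩ := hx
  have hpos : ∀ i ∈ W, 0 ≤ x i := fun i hi => by simpa [flipOutside, hi] using h0 i
  have hneg : ∀ i ∉ W, x i ≤ 0 := fun i hi => by simpa [flipOutside, hi] using h0 i
  -- The heaviest `P`-chain `M` in `W` fixes the convex weights: its sum for the `P`-part, the
  -- remainder to `1` for the `Q`-part. Joining any `Q`-chain off `W` to `M` gives a chain of `Δ_W`,
  -- so that remainder bounds the `Q`-chain sums.
  obtain ⟨M, hM, hmax⟩ := (Finset.univ.filter fun C : Finset (Fin d) =>
    C ⊆ W ∧ IsChain (fun i j => p i ≤ p j) (C : Set (Fin d))).exists_max_image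
      (fun C => ∑ i ∈ C, x i) ⟨∅, by simp⟩
  simp only [Finset.mem_filter, Finset.mem_univ, true_and] at hM hmax
  obtain ⟨hMW, hMchain⟩ := hM
  have hle : ∀ D : Finset (Fin d), D ⊆ Wᶜ → IsChain (fun i j => q i ≤ q j) (D : Set (Fin d)) →
      ∑ i ∈ D, -x i ≤ 1 - ∑ i ∈ M, x i := by
    intro D hDW hD
    have hdisj : Disjoint D W := Finset.subset_compl_iff_disjoint_right.1 hDW
    have e1 : (M ∪ D) ∩ W = M := by
      rw [Finset.union_inter_distrib_right, Finset.inter_eq_left.2 hMW,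
        Finset.disjoint_iff_inter_eq_empty.1 hdisj, Finset.union_empty]
    have e2 : (M ∪ D) \ W = D := by
      rw [Finset.union_sdiff_distrib, Finset.sdiff_eq_empty_iff_subset.2 hMW, Finset.empty_union,
        Finset.sdiff_eq_self_of_disjoint hdisj]
    have := h1 (M ∪ D) ((isChain_deltaEnum_iff p q W _).2 (by rw [e1, e2]; exact ⟨hMchain, hD⟩))
    rw [sum_flipOutside, e1, e2] at this
    linarith
  obtain ⟨a, ha, hax⟩ := exists_mem_chainPolytope_smul_eq p
    (u := fun i => if i ∈ W then x i else 0) (c := ∑ i ∈ M, x i)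
    (fun i => by split_ifs with h; exacts [hpos i h, le_rfl])
    (Finset.sum_nonneg fun i hi => hpos i (hMW hi)) (fun C hC => by
      rw [← Finset.sum_filter, Finset.filter_mem_eq_inter]
      exact hmax _ ⟨Finset.inter_subset_right, hC.mono (by simp)⟩)
  obtain ⟨b, hb, hbx⟩ := exists_mem_chainPolytope_smul_eq q
    (u := fun i => if i ∈ W then 0 else -x i) (c := 1 - ∑ i ∈ M, x i)
    (fun i => by split_ifs with h; exacts [le_rfl, neg_nonneg.2 (hneg i h)])
    (by simpa using hle ∅ (by simp) (by simp)) (fun C hC => by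
      have : ∑ i ∈ C, (if i ∈ W then 0 else -x i) = ∑ i ∈ C \ W, -x i := by
        simp [Finset.sum_ite, Finset.filter_notMem_eq_sdiff]
      rw [this]
      refine hle _ (fun i hi => ?_) (hC.mono (by simp))
      simpa using (Finset.mem_sdiff.1 hi).2)
  have hM0 : 0 ≤ ∑ i ∈ M, x i := Finset.sum_nonneg fun i hi => hpos i (hMW hi)
  have hM1 : 0 ≤ 1 - ∑ i ∈ M, x i := by simpa using hle ∅ (by simp) (by simp)
  have hxab : x = (∑ i ∈ M, x i) • a + (1 - ∑ i ∈ M, x i) • (-b) := by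
    rw [smul_neg, hax, hbx]
    ext i
    by_cases h : i ∈ W <;> simp [h]
  rw [hxab]
  exact convex_convexHull ℝ (chainPolytope p ∪ -chainPolytope q) (subset_convexHull ℝ _ (Or.inl ha))
    (subset_convexHull ℝ _ (Or.inr (by simpa using hb))) hM0 hM1 (by ring)

theorem twinnedChainPolytope_eq_biUnion :
    twinnedChainPolytope p q = ⋃ W ∈ (Finset.univ : Finset (Finset (Fin d))),
      flipOutside W ⁻¹' chainPolytope (deltaEnum p q W) := by
  ext x
  simp only [Finset.mem_univ, Set.iUnion_true, Set.mem_iUnion, Set.mem_preimage]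
  exact ⟨twinnedChainPolytope_subset p q,
    fun ⟨_, h⟩ => mem_twinnedChainPolytope_of_flipOutside_mem p q h⟩

theorem aedisjoint_flipOutside_preimage : Pairwise (Function.onFun (AEDisjoint volume)
    fun W => flipOutside W ⁻¹' chainPolytope (deltaEnum p q W)) := by
  intro V W hVW
  have hne : ∀ᵐ x : Fin d → ℝ, ∀ i, x i ≠ 0 :=
    ae_all_iff.2 fun i => Measure.ae_eval_ne (fun _ : Fin d => (volume : Measure ℝ)) i 0
  have h : ∀ᵐ x : Fin d → ℝ, x ∉ flipOutside V ⁻¹' chainPolytope (deltaEnum p q V) ∩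
      flipOutside W ⁻¹' chainPolytope (deltaEnum p q W) := by
    -- When no coordinate vanishes, the signs of `x` determine `W`.
    filter_upwards [hne] with x hx ⟨h1, h2⟩
    refine hVW (Finset.ext fun i => ?_)
    have h1 := h1.1 i
    have h2 := h2.1 i
    have hxi := hx i
    by_cases hV : i ∈ V <;> by_cases hW : i ∈ W <;> simp [flipOutside, hV, hW] at h1 h2 ⊢
    · exact hxi (le_antisymm h2 h1)
    · exact hxi (le_antisymm h1 h2)
  exact measure_eq_zero_iff_ae_notMem.2 h

end Twinned

theorem theorem1p4 {d : ℕ} {P Q : Type*} [PartialOrder P] [PartialOrder Q]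
    (p : Fin d ≃ P) (q : Fin d ≃ Q) :
    volume (twinnedChainPolytope p q) =
      ∑ W : Finset (Fin d), (numLinearExtensions (deltaEnum p q W) : ℝ≥0∞) / (d ! : ℝ≥0∞) := by
  rw [twinnedChainPolytope_eq_biUnion, measure_biUnion_finset₀
    ((aedisjoint_flipOutside_preimage p q).set_pairwise _) fun W _ =>
      ((measurePreserving_flipOutside W).measurable
        (measurableSet_chainPolytope _)).nullMeasurableSet]
  refine Finset.sum_congr rfl fun W _ => ?_
  rw [(measurePreserving_flipOutside W).measure_preimage
    (measurableSet_chainPolytope _).nullMeasurableSet, volume_chainPolytope]
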